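/- Let $X$ be a compact Kähler manifold of complex dimension $n$ with Kähler metric $g$ and Kähler form $\omega = i\sum g_{\alpha\bar\beta}\,dz^\alpha\wedge d\bar z^\beta$, and let $(E,\Phi)$ be a Higgs bundle over $X$: $E\to X$ is a holomorphic vector bundle of rank $r$, and $\Phi$ is a holomorphic $(1,0)$-form with values in $\mathrm{End}\,E$ such that $\Phi\wedge\Phi=0$. For a $C^\infty$ hermitian metric $h$ in $E$ let $D_h=D_h'+D_h''$ be its Chern connection, $F_h=D_h\wedge D_h$ the curvature of $D_h$, $D_h'\Phi$ the $\mathrm{End}\,E$-valued $(2,0)$-form obtained by applying the $(1,0)$-part of the exterior covariant derivative to $\Phi$, and $\bar\Phi_h$ the hermitian conjugate of $\Phi$, i.e. the $(0,1)$-form with $h(\bar\Phi_h s,s')=h(s,\Phi s')$ for all sections $s,s'$; put $[\Phi,\bar\Phi_h]=\Phi\wedge\bar\Phi_h+\bar\Phi_h\wedge\Phi$. For $\mathrm{End}\,E$-valued forms $\Psi$ let $$\|\Psi\|^2=\int_X|\Psi|^2\,\frac{\omega^n}{n!},\qquad |\Psi|^2=\sum_{A,B}\mathrm{tr}\bigl(\Psi_{A\bar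 B}\Psi_{A\bar B}^{\dagger}\bigr),$$ where $\Psi=\sum\Psi_{A\bar B}\,\theta^A\wedge\bar\theta^B$ (strictly increasing multi-indices) in a local $g$-unitary frame $\theta^1,\dots,\theta^n$ of $(1,0)$-forms and $\dagger$ is the adjoint of endomorphisms with respect to $h$. Consider, on the space of all hermitian metrics $h$ in $E$, the functional $$\mathcal H(h)=\|D_h'\Phi\|^2+\|F_h+[\Phi,\bar\Phi_h]\|^2 .$$ If a hermitian metric $h_0$ in $E$ satisfies $D'_{h_0}\Phi=0$ and $F_{h_0}+[\Phi,\bar\Phi_{h_0}]=0$, then $h_0$ is a minimum of $\mathcal H$, i.e. $\mathcal H(h_0)\le\mathcal H(h)$ for every hermitian metric $h$ in $E$. -/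

import Mathlib

open scoped Manifold ContDiff Bundle
open Bundle MeasureTheory

noncomputable section

namespace HiggsBundle

/-- The coordinate space `ℂⁿ`; it is the model space of complex `n`-dimensional manifolds and the
model fibre of vector bundles of rank `n`. -/
abbrev Cn (n : ℕ) : Type := EuclideanSpace ℂ (Fin n)

/-! ### Hermitian inner products on a finite dimensional complex vector space -/

section PointwiseAlgebra

variable {V : Type*} [AddCommGroup V] [Module ℂ V]

/-- A positive definite hermitian form `B`, linear in the first and conjugate linear in the
second slot. -/
structure IsHermitianInner (B : V →ₗ[ℂ] V →ₗ⋆[ℂ] ℂ) : Prop where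
  symm : ∀ v w, B w v = starRingEnd ℂ (B v w)
  pos : ∀ v, v ≠ 0 → 0 < (B v v).re

/-- The same inner product in the convention of Mathlib (conjugate linear in the first slot). -/
abbrev IsHermitianInner.core {B : V →ₗ[ℂ] V →ₗ⋆[ℂ] ℂ} (hB : IsHermitianInner B) :
    InnerProductSpace.Core ℂ V where
  inner v w := B w v
  conj_inner_symm v w := (hB.symm v w).symm
  re_inner_nonneg v := by
    by_cases h : v = 0
    · simp [h]
    · exact (hB.pos v h).le
  add_left u v w := by simp
  smul_left u v c := by simp
  definite v h := by
    by_contra h0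
    have := hB.pos v h0
    rw [h] at this
    simp at this

/-- Unitary bases exist. -/
theorem IsHermitianInner.exists_unitary [FiniteDimensional ℂ V] {B : V →ₗ[ℂ] V →ₗ⋆[ℂ] ℂ}
    (hB : IsHermitianInner B) {n : ℕ} (hn : Module.finrank ℂ V = n) :
    ∃ b : Module.Basis (Fin n) ℂ V, ∀ i j, B (b i) (b j) = if i = j then 1 else 0 := by
  let _ : NormedAddCommGroup V := hB.core.toNormedAddCommGroup
  let _ : InnerProductSpace ℂ V := InnerProductSpace.ofCore hB.core.toCore
  subst hn
  refine ⟨(stdOrthonormalBasis ℂ V).toBasis, fun i j => ?_⟩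
  have h := (orthonormal_iff_ite.1 (stdOrthonormalBasis ℂ V).orthonormal) j i
  rw [OrthonormalBasis.coe_toBasis]
  simp only [eq_comm (a := i)]
  exact h

/-- Adjoints with respect to a hermitian inner product exist. -/
theorem IsHermitianInner.exists_adjoint [FiniteDimensional ℂ V] {B : V →ₗ[ℂ] V →ₗ⋆[ℂ] ℂ}
    (hB : IsHermitianInner B) (T : Module.End ℂ V) :
    ∃ S : Module.End ℂ V, ∀ v w, B (S v) w = B v (T w) := by
  let _ : NormedAddCommGroup V := hB.core.toNormedAddCommGroup
  let _ : InnerProductSpace ℂ V := InnerProductSpace.ofCore hB.core.toCore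
  exact ⟨LinearMap.adjoint T, fun v w => LinearMap.adjoint_inner_right T w v⟩

theorem IsHermitianInner.adjoint_unique {B : V →ₗ[ℂ] V →ₗ⋆[ℂ] ℂ}
    (hB : IsHermitianInner B) {S S' : Module.End ℂ V}
    (h : ∀ v w, B (S v) w = B (S' v) w) : S = S' := by
  ext v
  by_contra h0
  have := hB.pos (S v - S' v) (sub_ne_zero.2 h0)
  rw [map_sub B, LinearMap.sub_apply, h v, sub_self] at this
  simp at this

/-- The wedge product `(α ∧ β)(u, v) = α(u) β(v) - α(v) β(u)` of two one-forms with values in an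
algebra. -/
def wedge {A : Type*} [Ring A] [Algebra ℝ A] (α β : V →ₗ[ℝ] A) : V [⋀^Fin 2]→ₗ[ℝ] A where
  toFun v := α (v 0) * β (v 1) - α (v 1) * β (v 0)
  map_update_add' v i x y := by
    have := Subsingleton.elim ‹DecidableEq (Fin 2)› (instDecidableEqFin 2)
    subst this
    fin_cases i <;> simp [add_mul, mul_add] <;> abel
  map_update_smul' v i c x := by
    have := Subsingleton.elim ‹DecidableEq (Fin 2)› (instDecidableEqFin 2)
    subst this
    fin_cases i <;> simp [smul_sub]
  map_eq_zero_of_eq' v i j h hij := by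
    have h01 : v 0 = v 1 := by fin_cases i <;> fin_cases j <;> simp_all
    simp [h01]

/-- The graded commutator `[α, β] = α ∧ β - (-1)^{1·1} β ∧ α` of two one-forms. -/
def bracket {A : Type*} [Ring A] [Algebra ℝ A] (α β : V →ₗ[ℝ] A) : V [⋀^Fin 2]→ₗ[ℝ] A :=
  wedge α β + wedge β α

end PointwiseAlgebra

/-! ### Types of forms on `ℂⁿ` -/

section Types

variable {V W : Type*} [NormedAddCommGroup V] [NormedSpace ℂ V]
  [NormedAddCommGroup W] [NormedSpace ℂ W]

/-- The complex linear part `u ↦ (L u - i L (i u)) / 2` of a real linear map.  Applied to the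
real differential of `f` it gives `∂f`. -/
def linearPart (L : V →L[ℝ] W) : V →L[ℝ] W :=
  (1 / 2 : ℂ) • (L - Complex.I • (L ∘L
    ((Complex.I • ContinuousLinearMap.id ℂ V).restrictScalars ℝ)))

/-- A one-form as an alternating map. -/
def asForm (α : V →L[ℝ] W) : V [⋀^Fin 1]→L[ℝ] W :=
  ContinuousAlternatingMap.ofSubsingleton ℝ V W (0 : Fin 1) α

/-- The exterior derivative `dα` of a one-form on a complex vector space. -/
def dForm (α : V → V →L[ℝ] W) (z : V) : V [⋀^Fin 2]→L[ℝ] W :=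
  extDeriv (fun y => asForm (α y)) z

/-- The operator `∂` on one-forms on a complex vector space: as the exterior derivative, but only
the complex linear part of the differential of the coefficients is used. -/
def delForm (α : V → V →L[ℝ] W) (z : V) : V [⋀^Fin 2]→L[ℝ] W :=
  ContinuousAlternatingMap.alternatizeUncurryFin
    (linearPart (fderiv ℝ (fun y => asForm (α y)) z))

end Types

section Bundles

variable {n r : ℕ} {X : Type*} [TopologicalSpace X] [ChartedSpace (Cn n) X]

/-- The coordinates around `x` are given by the chart `chartAt _ x`; this is the point with
coordinates `z`. -/
def point (x : X) (z : Cn n) : X := (chartAt (Cn n) x).symm z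

/-- The coordinates of `x` itself. -/
def center (x : X) : Cn n := chartAt (Cn n) x x

variable {E : X → Type*} [TopologicalSpace (TotalSpace (Cn r) E)]
  [∀ x, AddCommGroup (E x)] [∀ x, Module ℂ (E x)] [∀ x, TopologicalSpace (E x)]
  [FiberBundle (Cn r) E] [VectorBundle ℂ (Cn r) E]

theorem finiteDimensional_fiber (r : ℕ) (E : X → Type*) [TopologicalSpace (TotalSpace (Cn r) E)]
    [∀ x, AddCommGroup (E x)] [∀ x, Module ℂ (E x)] [∀ x, TopologicalSpace (E x)]
    [FiberBundle (Cn r) E] [VectorBundle ℂ (Cn r) E] (x : X) : FiniteDimensional ℂ (E x) :=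
  ((trivializationAt (Cn r) E x).linearEquivAt ℂ x
    (FiberBundle.mem_baseSet_trivializationAt' x)).symm.finiteDimensional

/-- The local frame at the point with coordinates `z`, as a linear map `ℂʳ → E`, coming from the
preferred trivialization around `x`.  (For a holomorphic bundle it is a holomorphic frame, and for
the tangent bundle it is the coordinate frame of the chart around `x`.) -/
def frame (E : X → Type*) [TopologicalSpace (TotalSpace (Cn r) E)]
    [∀ x, AddCommGroup (E x)] [∀ x, Module ℂ (E x)] [∀ x, TopologicalSpace (E x)]
    [FiberBundle (Cn r) E] [VectorBundle ℂ (Cn r) E] (x : X) (z : Cn n) :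
    Cn r →ₗ[ℂ] E (point x z) :=
  (trivializationAt (Cn r) E x).symmₗ ℂ (point x z)

/-- The components with respect to the local frame at the point with coordinates `z`. -/
def coframe (E : X → Type*) [TopologicalSpace (TotalSpace (Cn r) E)]
    [∀ x, AddCommGroup (E x)] [∀ x, Module ℂ (E x)] [∀ x, TopologicalSpace (E x)]
    [FiberBundle (Cn r) E] [VectorBundle ℂ (Cn r) E] (x : X) (z : Cn n) :
    E (point x z) →ₗ[ℂ] Cn r :=
  (trivializationAt (Cn r) E x).linearMapAt ℂ (point x z)

variable (n r E) in
/-- A hermitian metric in `E`: a field of hermitian inner products in the fibres such that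
`h(s, s')` is a `C^∞` function for all (local) `C^∞` sections `s, s'`, where `C^∞` refers to the
underlying real manifolds. -/
structure HermitianMetric where
  form : ∀ x, E x →ₗ[ℂ] E x →ₗ⋆[ℂ] ℂ
  isInner : ∀ x, IsHermitianInner (form x)
  smooth : ∀ (U : Set X) (s s' : ∀ x, E x), IsOpen U →
    ContMDiffOn 𝓘(ℝ, Cn n) (𝓘(ℝ, Cn n).prod 𝓘(ℝ, Cn r)) ∞
      (fun x => TotalSpace.mk' (Cn r) x (s x)) U →
    ContMDiffOn 𝓘(ℝ, Cn n) (𝓘(ℝ, Cn n).prod 𝓘(ℝ, Cn r)) ∞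
      (fun x => TotalSpace.mk' (Cn r) x (s' x)) U →
    ContMDiffOn 𝓘(ℝ, Cn n) 𝓘(ℝ, ℂ) ∞ (fun x => form x (s x) (s' x)) U

namespace HermitianMetric

variable (h : HermitianMetric n r E)

/-- The hermitian conjugate of an endomorphism: `h(T* v, w) = h(v, T w)`. -/
def conj (x : X) (T : Module.End ℂ (E x)) : Module.End ℂ (E x) :=
  haveI := finiteDimensional_fiber r E x
  ((h.isInner x).exists_adjoint T).choose

theorem conj_spec (x : X) (T : Module.End ℂ (E x)) (v w : E x) :
    h.form x (h.conj x T v) w = h.form x v (T w) :=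
  haveI := finiteDimensional_fiber r E x
  ((h.isInner x).exists_adjoint T).choose_spec v w

/-- The local expression `H` of the metric: the operator on `ℂʳ` with
`⟪w, H v⟫ = h(frame v, frame w)`, i.e. the matrix of `H` is the (transposed) matrix
`h(e_i, e_k)` of the metric in the local frame. -/
def gram (x : X) (z : Cn n) : Cn r →L[ℂ] Cn r :=
  LinearMap.toContinuousLinearMap
    { toFun := fun v => WithLp.toLp 2 fun i =>
        h.form (point x z) (frame E x z v) (frame E x z (EuclideanSpace.single i 1))
      map_add' := fun v w => by ext i; simp
      map_smul' := fun c v => by ext i; simp }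

theorem inner_gram (x : X) (z : Cn n) (v w : Cn r) :
    inner ℂ w (h.gram x z v) = h.form (point x z) (frame E x z v) (frame E x z w) := by
  have hw : w = ∑ i, w i • EuclideanSpace.single i (1 : ℂ) := by
    ext j
    simp [Finset.sum_apply, Pi.single_apply]
  conv_rhs => rw [hw]
  simp [gram, PiLp.inner_apply, mul_comm]

/-- The connection form `A_h = H⁻¹ ∂H`, in the local frame around `x`, of the Chern connection
`D_h = d + A_h`.  It is the unique `(1,0)`-form compatible with the metric; see the two lemmas below. -/
def connectionForm (x : X) (z : Cn n) : Cn n →L[ℝ] (Cn r →L[ℂ] Cn r) :=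
  (ContinuousLinearMap.mul ℝ (Cn r →L[ℂ] Cn r) (Ring.inverse (h.gram x z))) ∘L
    linearPart (fderiv ℝ (h.gram x) z)

/-- `A_h` is of type `(1,0)`, so that `D_h'' = d''` in the holomorphic frame. -/
theorem connectionForm_I_smul (x : X) (z u : Cn n) :
    h.connectionForm x z (Complex.I • u) = Complex.I • h.connectionForm x z u := by
  have key : ∀ L : Cn n →L[ℝ] (Cn r →L[ℂ] Cn r),
      linearPart L (Complex.I • u) = Complex.I • linearPart L u := by
    intro L
    have h1 : ∀ w, linearPart L w =
      (1 / 2 : ℂ) • (L w - Complex.I • L (Complex.I • w)) := fun _ => rfl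
    rw [h1, h1, smul_smul Complex.I Complex.I u, Complex.I_mul_I, neg_one_smul, map_neg,
      smul_comm Complex.I (1 / 2 : ℂ), smul_sub Complex.I, smul_smul Complex.I Complex.I,
      Complex.I_mul_I]
    module
  simp only [connectionForm, ContinuousLinearMap.comp_apply, key,
    ContinuousLinearMap.mul_apply', mul_smul_comm]

/-- `D_h = d + A_h` is compatible with the metric: `d h(v,w) = h(A_h v, w) + h(v, A_h w)` for
vectors `v, w` that are constant in the local frame. -/
theorem connectionForm_compatible (x : X) (z : Cn n)
    (hz : point x z ∈ (trivializationAt (Cn r) E x).baseSet)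
    (hd : DifferentiableAt ℝ (h.gram x) z) (u : Cn n) (v w : Cn r) :
    fderiv ℝ (fun y : Cn n => h.form (point x y) (frame E x y v) (frame E x y w)) z u =
      h.form (point x z) (frame E x z (h.connectionForm x z u v)) (frame E x z w) +
      h.form (point x z) (frame E x z v) (frame E x z (h.connectionForm x z u w)) := by
  have hinj : Function.Injective (frame (r:=r) E x z) := by
    intro a b hab
    have := congrArg (coframe (r:=r) E x z) hab
    simpa [frame, coframe, Trivialization.linearMapAt_symmₗ _ hz] using this
  have hU : IsUnit (h.gram x z) := by
    have : Function.Injective (h.gram x z) := by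
      rw [injective_iff_map_eq_zero]
      intro a ha
      by_contra h0
      have h1 := (h.isInner (point x z)).pos (frame (r:=r) E x z a) (fun h2 => h0 (hinj (by simpa using h2)))
      rw [← h.inner_gram, ha] at h1
      simp at h1
    let e := LinearEquiv.ofInjectiveEndo (h.gram x z : Cn r →ₗ[ℂ] Cn r) this
    refine ⟨⟨h.gram x z, e.symm.toContinuousLinearEquiv, ?_, ?_⟩, rfl⟩
    · ext1 a; exact e.apply_symm_apply a
    · ext1 a; exact e.symm_apply_apply a
  have hmul : ∀ T : Cn r →L[ℂ] Cn r, ∀ a, h.gram x z ((Ring.inverse (h.gram x z) * T) a) = T a := by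
    intro T a
    rw [← mul_apply_eq_comp, ← mul_assoc, Ring.mul_inverse_cancel _ hU, one_mul]
  have hderiv : ∀ v w u, fderiv ℝ (fun z : Cn n => h.form (point x z) (frame E x z v) (frame E x z w)) z u = inner ℂ w (fderiv ℝ (h.gram x) z u v) := by
    intro v w u
    simp_rw [← h.inner_gram]
    let L : (Cn r →L[ℂ] Cn r) →L[ℝ] ℂ := ((innerSL ℂ w) ∘L (ContinuousLinearMap.apply ℂ (Cn r) v)).restrictScalars ℝ
    exact congrArg (· u) (L.hasFDerivAt.comp z hd.hasFDerivAt).fderiv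
  have hself : ∀ v w u, inner ℂ w (fderiv ℝ (h.gram x) z u v) = (starRingEnd ℂ) (inner ℂ v (fderiv ℝ (h.gram x) z u w)) := by
    intro v w u
    rw [← hderiv, ← hderiv]
    have : (fun z : Cn n => h.form (point x z) (frame E x z v) (frame E x z w)) = fun z : Cn n => Complex.conjCLE (h.form (point x z) (frame E x z w) (frame E x z v)) := by
      funext y; exact (h.isInner _).symm _ _
    rw [this]
    have := Complex.conjCLE.comp_fderiv (f := fun z : Cn n => h.form (point x z) (frame E x z w) (frame E x z v)) (x := z)
    exact congrArg (· u) this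
  rw [hderiv, (h.isInner _).symm (frame E x z (h.connectionForm x z u w)) (frame E x z v), ← h.inner_gram, ← h.inner_gram]
  simp only [HermitianMetric.connectionForm, ContinuousLinearMap.comp_apply, ContinuousLinearMap.mul_apply', hmul]
  simp only [linearPart, _root_.smul_apply, _root_.sub_apply, ContinuousLinearMap.comp_apply, inner_smul_right, inner_sub_right, map_mul, map_sub, ← hself]
  have h2 : (starRingEnd ℂ) (2 : ℂ) = 2 := map_ofNat _ 2
  simp [h2]
  ring

end HermitianMetric

/-! ### Forms with values in `End E` -/

section Forms

variable [IsManifold 𝓘(ℂ, Cn n) ω X]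

/-- Two-forms at `x` (real multilinear, of arbitrary type) with values in `End E`. -/
abbrev EndTwoForm (n : ℕ) {X : Type*} [TopologicalSpace X] [ChartedSpace (Cn n) X]
    (E : X → Type*) [∀ x, AddCommGroup (E x)] [∀ x, Module ℂ (E x)] (x : X) :=
  TangentSpace 𝓘(ℂ, Cn n) x [⋀^Fin 2]→ₗ[ℝ] Module.End ℂ (E x)

/-- The endomorphism of `E` with a given matrix in the local frame, at the point `x`. -/
def endOfLocal (E : X → Type*) [TopologicalSpace (TotalSpace (Cn r) E)]
    [∀ x, AddCommGroup (E x)] [∀ x, Module ℂ (E x)] [∀ x, TopologicalSpace (E x)]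
    [FiberBundle (Cn r) E] [VectorBundle ℂ (Cn r) E] (x : X) :
    (Cn r →L[ℂ] Cn r) →ₗ[ℝ] Module.End ℂ (E x) where
  toFun T := (trivializationAt (Cn r) E x).symmₗ ℂ x ∘ₗ (T : Cn r →ₗ[ℂ] Cn r) ∘ₗ
    (trivializationAt (Cn r) E x).linearMapAt ℂ x
  map_add' S T := by ext v; simp
  map_smul' c T := by
    ext v
    simp [← Complex.coe_smul]

/-- The value at `x` of an `End E`-valued two-form whose expression in the coordinates and in the
local frame around `x` has the value `α` at the centre. -/
def ofLocal (E : X → Type*) [TopologicalSpace (TotalSpace (Cn r) E)]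
    [∀ x, AddCommGroup (E x)] [∀ x, Module ℂ (E x)] [∀ x, TopologicalSpace (E x)]
    [FiberBundle (Cn r) E] [VectorBundle ℂ (Cn r) E] (x : X)
    (α : Cn n [⋀^Fin 2]→ₗ[ℝ] (Cn r →L[ℂ] Cn r)) : EndTwoForm n E x :=
  (endOfLocal E x).compAlternatingMap (α.compLinearMap
    (((trivializationAt (Cn n) (TangentSpace 𝓘(ℂ, Cn n)) x).linearMapAt ℂ x).restrictScalars ℝ))

/-- The Chern curvature `F_h = D_h ∧ D_h`, locally `dA_h + A_h ∧ A_h`. -/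
def HermitianMetric.curvature (h : HermitianMetric n r E) (x : X) : EndTwoForm n E x :=
  ofLocal E x ((dForm (h.connectionForm x) (center x)).toAlternatingMap +
    wedge (h.connectionForm x (center x) : Cn n →ₗ[ℝ] (Cn r →L[ℂ] Cn r))
      (h.connectionForm x (center x) : Cn n →ₗ[ℝ] (Cn r →L[ℂ] Cn r)))

/-- The expression, in the coordinates and in the local frame around `x`, of a `(1,0)`-form with
values in `End E`, i.e. of a field of complex linear maps `T_yX → End E_y`. -/
def localForm (Φ : ∀ x, TangentSpace 𝓘(ℂ, Cn n) x →ₗ[ℂ] Module.End ℂ (E x)) (x : X)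
    (z : Cn n) : Cn n →L[ℂ] (Cn r →L[ℂ] Cn r) :=
  LinearMap.toContinuousLinearMap
    { toFun := fun u => LinearMap.toContinuousLinearMap
        (coframe E x z ∘ₗ Φ (point x z) (frame (TangentSpace 𝓘(ℂ, Cn n)) x z u) ∘ₗ frame E x z)
      map_add' := fun u v => by ext w; simp
      map_smul' := fun c u => by ext w; simp }

variable (n r E) in
/-- A Higgs field in `E`: a holomorphic `(1,0)`-form `Φ` with values in `End E` that satisfies
`Φ ∧ Φ = 0`. -/
structure HiggsField where
  toFun : ∀ x, TangentSpace 𝓘(ℂ, Cn n) x →ₗ[ℂ] Module.End ℂ (E x)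
  holomorphic : ∀ x, DifferentiableOn ℂ (localForm (r := r) toFun x)
    ((chartAt (Cn n) x).target ∩ point x ⁻¹' (trivializationAt (Cn r) E x).baseSet)
  wedge_self : ∀ x, wedge ((toFun x).restrictScalars ℝ) ((toFun x).restrictScalars ℝ) = 0

/-- The `(2,0)`-form `D'_h Φ`, locally `∂Φ + [A_h, Φ]`. -/
def HiggsField.D' (Φ : HiggsField n r E) (h : HermitianMetric n r E) (x : X) :
    EndTwoForm n E x :=
  ofLocal E x
    ((delForm (fun z => (localForm (r := r) Φ.toFun x z).restrictScalars ℝ) (center x)).toAlternatingMap +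
      bracket (h.connectionForm x (center x) : Cn n →ₗ[ℝ] (Cn r →L[ℂ] Cn r))
        ((localForm (r := r) Φ.toFun x (center x)).restrictScalars ℝ : Cn n →ₗ[ℝ] (Cn r →L[ℂ] Cn r)))

/-- The hermitian conjugate `Φ̄_h`, a `(0,1)`-form with values in `End E`. -/
def HiggsField.bar (Φ : HiggsField n r E) (h : HermitianMetric n r E) (x : X) :
    TangentSpace 𝓘(ℂ, Cn n) x →ₗ[ℝ] Module.End ℂ (E x) where
  toFun u := h.conj x (Φ.toFun x u)
  map_add' u v := (h.isInner x).adjoint_unique fun a b => by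
    simp only [h.conj_spec, map_add, LinearMap.add_apply]
  map_smul' c u := (h.isInner x).adjoint_unique fun a b => by
    have : c • u = (c : ℂ) • u := (Complex.coe_smul c u).symm
    simp [h.conj_spec, this, ← Complex.coe_smul]

/-- The two-form `F_h + [Φ, Φ̄_h]`. -/
def HiggsField.hitchinForm (Φ : HiggsField n r E) (h : HermitianMetric n r E) (x : X) :
    EndTwoForm n E x :=
  h.curvature x + bracket ((Φ.toFun x).restrictScalars ℝ) (Φ.bar h x)

/-- The (reduced) `2k`-Hitchin equations `D'_h Φ = 0` and `F_h + [Φ, Φ̄_h] = 0`. -/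
def HiggsField.SolvesHitchin (Φ : HiggsField n r E) (h : HermitianMetric n r E) : Prop :=
  (∀ x, Φ.D' h x = 0) ∧ (∀ x, Φ.hitchinForm h x = 0)

/-! ### Kähler metrics -/

/-- The fundamental form `ω = i ∑ g_{αβ̄} dz^α ∧ dz̄^β`, that is
`ω(u, v) = i (g(u, v) - g(v, u)) = -2 Im g(u, v)`, of a hermitian metric on the tangent bundle. -/
def fundamentalForm (g : HermitianMetric n n (TangentSpace 𝓘(ℂ, Cn n) : X → Type)) (x : X) :
    TangentSpace 𝓘(ℂ, Cn n) x [⋀^Fin 2]→ₗ[ℝ] ℝ where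
  toFun v := -2 * (g.form x (v 0) (v 1)).im
  map_update_add' v i a b := by
    have := Subsingleton.elim ‹DecidableEq (Fin 2)› (instDecidableEqFin 2)
    subst this
    fin_cases i <;> simp <;> ring
  map_update_smul' v i c a := by
    have := Subsingleton.elim ‹DecidableEq (Fin 2)› (instDecidableEqFin 2)
    subst this
    have hc : c • a = (c : ℂ) • a := (Complex.coe_smul c a).symm
    fin_cases i <;> simp [hc, -Complex.coe_smul] <;> ring
  map_eq_zero_of_eq' v i j h hij := by
    have h01 : v 0 = v 1 := by fin_cases i <;> fin_cases j <;> simp_all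
    have := (g.isInner x).symm (v 1) (v 1)
    have h2 := congrArg Complex.im this
    simp only [Complex.conj_im] at h2
    simp only [h01]
    linarith

/-- The fundamental form in the coordinates around `x`. -/
def localFundamentalForm (g : HermitianMetric n n (TangentSpace 𝓘(ℂ, Cn n) : X → Type)) (x : X)
    (z : Cn n) : Cn n [⋀^Fin 2]→L[ℝ] ℝ where
  toAlternatingMap := (fundamentalForm g (point x z)).compLinearMap
    ((frame (TangentSpace 𝓘(ℂ, Cn n)) x z).restrictScalars ℝ)
  cont := by
    have : Continuous fun v : Fin 2 → Cn n =>
        -2 * (inner ℂ (v 1) (g.gram x z (v 0)) : ℂ).im := by fun_prop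
    refine this.congr fun v => ?_
    rw [g.inner_gram]
    rfl

variable (n X) in
/-- A Kähler metric on `X`: a hermitian metric on the (holomorphic) tangent bundle with closed
fundamental form. -/
structure KahlerMetric extends HermitianMetric n n (TangentSpace 𝓘(ℂ, Cn n) : X → Type) where
  closed : ∀ x, extDeriv (localFundamentalForm toHermitianMetric x) (center x) = 0

/-- The measure `ω^n / n!` on the image in `X` of the coordinate domain around `x`: in
coordinates, `ω^n / n! = det (g_{αβ̄}) ∏ i dz^α ∧ dz̄^α = 2^n det (g_{αβ̄}) dλ` with the Lebesgue
measure `λ` of `ℂⁿ`. -/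
def KahlerMetric.chartVolume [MeasurableSpace X] (g : KahlerMetric n X) (x : X) : Measure X :=
  (((volume : Measure (Cn n)).restrict (chartAt (Cn n) x).target).withDensity fun z =>
    ENNReal.ofReal (2 ^ n * (Matrix.of fun α β : Fin n => g.form (point x z)
      (frame (TangentSpace 𝓘(ℂ, Cn n)) x z (EuclideanSpace.single α 1))
      (frame (TangentSpace 𝓘(ℂ, Cn n)) x z (EuclideanSpace.single β 1))).det.re)).map (point x)

/-- The measure `ω^n / n!` on `X`.  The measures on the coordinate domains agree on overlaps, and
their supremum in the lattice of measures is the measure that restricts to each of them. -/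
def KahlerMetric.volume [MeasurableSpace X] (g : KahlerMetric n X) : Measure X :=
  ⨆ x, g.chartVolume x

theorem KahlerMetric.exists_unitaryFrame (g : KahlerMetric n X) (x : X) :
    ∃ b : Module.Basis (Fin n) ℂ (TangentSpace 𝓘(ℂ, Cn n) x),
      ∀ i j, g.form x (b i) (b j) = if i = j then 1 else 0 :=
  haveI := finiteDimensional_fiber n (TangentSpace 𝓘(ℂ, Cn n) : X → Type) x
  (g.isInner x).exists_unitary (finrank_euclideanSpace_fin (𝕜 := ℂ) (n := n))

/-- A unitary frame of the tangent space at `x`, dual to a unitary frame `θ^α` of `(1,0)`-forms. -/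
def KahlerMetric.unitaryFrame (g : KahlerMetric n X) (x : X) :
    Module.Basis (Fin n) ℂ (TangentSpace 𝓘(ℂ, Cn n) x) :=
  (g.exists_unitaryFrame x).choose

/-! ### The inner product of forms with values in `End E` -/

/-- The value `Ψ(Z, W)` of the complex bilinear extension of `Ψ` at `Z = (u - i a J u) / 2` and
`W = (v - i b J v) / 2`, where `J` is the complex structure of the tangent space.  For `a = 1`
the vector `Z` is the `(1,0)`-part of `u`, for `a = -1` it is the `(0,1)`-part. -/
def component {x : X} (Ψ : EndTwoForm n E x) (a b : ℂ) (u v : TangentSpace 𝓘(ℂ, Cn n) x) :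
    Module.End ℂ (E x) :=
  (1 / 4 : ℂ) • (Ψ ![u, v] - (Complex.I * a) • Ψ ![Complex.I • u, v]
    - (Complex.I * b) • Ψ ![u, Complex.I • v]
    - (a * b) • Ψ ![Complex.I • u, Complex.I • v])

/-- The local hermitian inner product `(Ψ, Ξ) = ∑ tr (Ψ_{AB̄} Ξ_{AB̄}^†)`, the sum being over the
components of type `(2,0)`, `(1,1)` and `(0,2)` (ordered multi-indices) with respect to a unitary
frame `θ^α`; it does not depend on the frame. -/
def localInner (g : KahlerMetric n X) (h : HermitianMetric n r E) (x : X)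
    (Ψ Ξ : EndTwoForm n E x) : ℂ :=
  let ε := g.unitaryFrame x
  let pair := fun (a b : ℂ) (α β : Fin n) => LinearMap.trace ℂ (E x)
    (component Ψ a b (ε α) (ε β) * h.conj x (component Ξ a b (ε α) (ε β)))
  (∑ α, ∑ β, if α < β then pair 1 1 α β else 0) +
    (∑ α, ∑ β, pair 1 (-1) α β) +
    (∑ α, ∑ β, if α < β then pair (-1) (-1) α β else 0)

/-- The global hermitian inner product `⟨Ψ, Ξ⟩ = ∫_X (Ψ, Ξ) ω^n / n!`. -/
def globalInner [MeasurableSpace X] (g : KahlerMetric n X) (h : HermitianMetric n r E)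
    (Ψ Ξ : ∀ x, EndTwoForm n E x) : ℂ :=
  ∫ x, localInner g h x (Ψ x) (Ξ x) ∂g.volume

/-- The square `‖Ψ‖² = ⟨Ψ, Ψ⟩` of the global norm. -/
def normSq [MeasurableSpace X] (g : KahlerMetric n X) (h : HermitianMetric n r E)
    (Ψ : ∀ x, EndTwoForm n E x) : ℝ :=
  (globalInner g h Ψ Ψ).re

/-- The non-abelian Seiberg–Witten functional
`ℋ(h) = ‖D'_h Φ‖² + ‖F_h + [Φ, Φ̄_h]‖²` on the space of hermitian metrics of `E`. -/
def seibergWitten [MeasurableSpace X] (g : KahlerMetric n X) (Φ : HiggsField n r E)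
    (h : HermitianMetric n r E) : ℝ :=
  normSq g h (Φ.D' h) + normSq g h (Φ.hitchinForm h)

end Forms

end Bundles

end HiggsBundle

end

/-!
The functional `ℋ` is a sum of two squared `L²`-norms. Fibrewise, `tr (T T†)` is the sum of the
squared lengths of the vectors `T† e_i` for an `h`-unitary basis `e_i`, so it is a non-negative real
number (`trace_mul_conj_nonneg`); hence so are the integrand `localInner g h x Ψ Ψ` and its integral,
for every metric `h`. At a solution `h₀` of the Hitchin equations both forms vanish identically, so
`ℋ(h₀) = 0`.
-/

namespace HiggsBundle

open scoped ComplexOrder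

/-- The trace of an endomorphism in a unitary basis. -/
theorem IsHermitianInner.trace_eq_sum {V : Type*} [AddCommGroup V] [Module ℂ V]
    {B : V →ₗ[ℂ] V →ₗ⋆[ℂ] ℂ} {m : ℕ} (b : Module.Basis (Fin m) ℂ V)
    (hb : ∀ i j, B (b i) (b j) = if i = j then 1 else 0) (T : Module.End ℂ V) :
    LinearMap.trace ℂ V T = ∑ i, B (T (b i)) (b i) := by
  have hrepr (v : V) (i : Fin m) : b.repr v i = B v (b i) := by
    conv_rhs => rw [← b.sum_repr v]
    simp only [map_sum, map_smul, LinearMap.sum_apply, LinearMap.smul_apply, hb]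
    simp
  simp [LinearMap.trace_eq_matrix_trace ℂ b, Matrix.trace, LinearMap.toMatrix_apply, hrepr]

theorem IsHermitianInner.self_nonneg {V : Type*} [AddCommGroup V] [Module ℂ V]
    {B : V →ₗ[ℂ] V →ₗ⋆[ℂ] ℂ} (hB : IsHermitianInner B) (v : V) : 0 ≤ B v v := by
  rw [Complex.nonneg_iff]
  exact ⟨hB.core.re_inner_nonneg v, (Complex.conj_eq_iff_im.1 (hB.symm v v).symm).symm⟩

section Bundles

variable {n r : ℕ} {X : Type*} [TopologicalSpace X] [ChartedSpace (Cn n) X]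
  {E : X → Type*} [TopologicalSpace (TotalSpace (Cn r) E)]
  [∀ x, AddCommGroup (E x)] [∀ x, Module ℂ (E x)] [∀ x, TopologicalSpace (E x)]
  [FiberBundle (Cn r) E] [VectorBundle ℂ (Cn r) E]

theorem HermitianMetric.trace_mul_conj_nonneg (h : HermitianMetric n r E) (x : X)
    (T : Module.End ℂ (E x)) : 0 ≤ LinearMap.trace ℂ (E x) (T * h.conj x T) := by
  have := finiteDimensional_fiber r E x
  obtain ⟨b, hb⟩ := (h.isInner x).exists_unitary rfl
  rw [IsHermitianInner.trace_eq_sum b hb]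
  refine Finset.sum_nonneg fun i _ => ?_
  -- `h(T T† e, e)` is the conjugate of `h(e, T T† e) = h(T† e, T† e)`, which is real.
  rw [(h.isInner x).symm, Module.End.mul_apply, ← h.conj_spec, ← (h.isInner x).symm]
  exact (h.isInner x).self_nonneg _

variable [IsManifold 𝓘(ℂ, Cn n) ω X]

theorem localInner_self_nonneg (g : KahlerMetric n X) (h : HermitianMetric n r E) (x : X)
    (Ψ : EndTwoForm n E x) : 0 ≤ localInner g h x Ψ Ψ := by
  refine add_nonneg (add_nonneg ?_ ?_) ?_ <;>
    refine Finset.sum_nonneg fun α _ => Finset.sum_nonneg fun β _ => ?_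
  · split_ifs
    exacts [h.trace_mul_conj_nonneg x _, le_rfl]
  · exact h.trace_mul_conj_nonneg x _
  · split_ifs
    exacts [h.trace_mul_conj_nonneg x _, le_rfl]

@[simp]
theorem localInner_zero_left (g : KahlerMetric n X) (h : HermitianMetric n r E) (x : X)
    (Ξ : EndTwoForm n E x) : localInner g h x 0 Ξ = 0 := by
  simp [localInner, component]

variable [MeasurableSpace X]

/-- The integrand is pointwise a non-negative real number, so the integral is non-negative without a
separate discussion of integrability. -/
theorem normSq_nonneg (g : KahlerMetric n X) (h : HermitianMetric n r E)
    (Ψ : ∀ x, EndTwoForm n E x) : 0 ≤ normSq g h Ψ :=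
  (Complex.nonneg_iff.1 (integral_nonneg fun x => localInner_self_nonneg g h x (Ψ x))).1

theorem normSq_eq_zero_of_forall (g : KahlerMetric n X) (h : HermitianMetric n r E)
    {Ψ : ∀ x, EndTwoForm n E x} (hΨ : ∀ x, Ψ x = 0) : normSq g h Ψ = 0 := by
  simp [normSq, globalInner, hΨ]

theorem seibergWitten_nonneg (g : KahlerMetric n X) (Φ : HiggsField n r E)
    (h : HermitianMetric n r E) : 0 ≤ seibergWitten g Φ h :=
  add_nonneg (normSq_nonneg g h _) (normSq_nonneg g h _)

theorem HiggsField.SolvesHitchin.seibergWitten_eq_zero (g : KahlerMetric n X)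
    {Φ : HiggsField n r E} {h : HermitianMetric n r E} (hh : Φ.SolvesHitchin h) :
    seibergWitten g Φ h = 0 := by
  rw [seibergWitten, normSq_eq_zero_of_forall g h hh.1, normSq_eq_zero_of_forall g h hh.2, add_zero]

end Bundles

end HiggsBundle

theorem proposition5p1 {n r : ℕ} {X : Type*} [TopologicalSpace X] [CompactSpace X] [T2Space X]
    [ChartedSpace (HiggsBundle.Cn n) X] [IsManifold 𝓘(ℂ, HiggsBundle.Cn n) ω X]
    [MeasurableSpace X] [BorelSpace X] (g : HiggsBundle.KahlerMetric n X)
    {E : X → Type*} [TopologicalSpace (TotalSpace (HiggsBundle.Cn r) E)]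
    [∀ x, AddCommGroup (E x)] [∀ x, Module ℂ (E x)] [∀ x, TopologicalSpace (E x)]
    [FiberBundle (HiggsBundle.Cn r) E] [VectorBundle ℂ (HiggsBundle.Cn r) E]
    [ContMDiffVectorBundle ω (HiggsBundle.Cn r) E 𝓘(ℂ, HiggsBundle.Cn n)]
    (Φ : HiggsBundle.HiggsField n r E) (h₀ : HiggsBundle.HermitianMetric n r E)
    (hh₀ : Φ.SolvesHitchin h₀) (h : HiggsBundle.HermitianMetric n r E) :
    HiggsBundle.seibergWitten g Φ h₀ ≤ HiggsBundle.seibergWitten g Φ h := by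
  rw [hh₀.seibergWitten_eq_zero g]
  exact HiggsBundle.seibergWitten_nonneg g Φ h
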